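/- Let $\mathcal{A}$ be the disc algebra, i.e. the complex Banach algebra of all continuous functions $f:\{z\in\mathbb{C}:|z|\le 1\}\to\mathbb{C}$ that are holomorphic on $\{|z|<1\}$, with pointwise operations and the supremum norm. For every $A\in \mathrm{GL}_2(\mathcal{A})$, i.e. every invertible $2\times 2$ matrix over $\mathcal{A}$, there exist matrices $B,C\in \mathrm{M}_2(\mathcal{A})$ such that $$A=\exp(B)\exp(C),\qquad\text{where } \exp(X)=\sum_{n\ge 0}\frac{X^n}{n!}.$$ -/

import Mathlib

open scoped MatrixGroups

/-- The disc algebra: continuous functions on the closed unit disc that are holomorphic on the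
open unit disc. (`Function.extend` extends `f` by zero outside the closed disc; this does not
affect differentiability on the open disc.) As a subalgebra of `C(closed disc, ℂ)` it carries the
pointwise operations and the supremum norm. -/
noncomputable def discAlgebra : Subalgebra ℂ C(Metric.closedBall (0 : ℂ) 1, ℂ) where
  carrier := {f | DifferentiableOn ℂ
    (Function.extend (Subtype.val : Metric.closedBall (0 : ℂ) 1 → ℂ) f 0) (Metric.ball 0 1)}
  mul_mem' {f g} hf hg := by
    have h := Function.extend_mul (Subtype.val : Metric.closedBall (0 : ℂ) 1 → ℂ) f g 0 0
    rw [mul_zero] at h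
    simp only [Set.mem_ofPred_eq, ContinuousMap.coe_mul, h] at *
    exact hf.mul hg
  add_mem' {f g} hf hg := by
    have h := Function.extend_add (Subtype.val : Metric.closedBall (0 : ℂ) 1 → ℂ) f g 0 0
    rw [add_zero] at h
    simp only [Set.mem_ofPred_eq, ContinuousMap.coe_add, h] at *
    exact hf.add hg
  algebraMap_mem' c := by
    refine (differentiableOn_const c).congr fun z hz => ?_
    exact Subtype.val_injective.extend_apply _ _ (⟨z, Metric.ball_subset_closedBall hz⟩ :
      Metric.closedBall (0 : ℂ) 1)

/-- The disc algebra is complete, hence a Banach algebra. -/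
instance : CompleteSpace discAlgebra := by
  refine IsClosed.completeSpace_coe (s := (discAlgebra : Set C(Metric.closedBall (0 : ℂ) 1, ℂ)))
    (hs := ?_)
  refine isClosed_of_closure_subset fun f hf => ?_
  obtain ⟨u, hu, hlim⟩ := mem_closure_iff_seq_limit.1 hf
  have hunif := ContinuousMap.tendsto_iff_tendstoUniformly.1 hlim
  refine TendstoLocallyUniformlyOn.differentiableOn (φ := Filter.atTop)
    (F := fun n => Function.extend (Subtype.val : Metric.closedBall (0 : ℂ) 1 → ℂ) (u n) 0)
    (TendstoUniformlyOn.tendstoLocallyUniformlyOn ?_) (Filter.Eventually.of_forall hu)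
    Metric.isOpen_ball
  rw [Metric.tendstoUniformlyOn_iff]
  intro ε hε
  filter_upwards [Metric.tendstoUniformly_iff.1 hunif ε hε] with n hn z hz
  have hz' : z ∈ Metric.closedBall (0 : ℂ) 1 := Metric.ball_subset_closedBall hz
  have e (g : Metric.closedBall (0 : ℂ) 1 → ℂ) :
      Function.extend (Subtype.val : Metric.closedBall (0 : ℂ) 1 → ℂ) g 0 z = g ⟨z, hz'⟩ :=
    Subtype.val_injective.extend_apply g 0 ⟨z, hz'⟩
  rw [e, e]
  exact hn ⟨z, hz'⟩

/-! Two properties of the disc algebra suffice: every unit is an exponential, and the stable rank is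
one. By stable rank one, conjugation by a unipotent matrix makes the upper left entry a unit
(`exists_eq_exp_mul_exp`). The matrix then factors as lower times upper triangular, and a scalar
moved between the factors makes the two diagonal entries of each differ by a unit. Each factor is
thus conjugate to a diagonal matrix of units, hence is an exponential.

Units are exponentials because dilations join them to nonzero constants. For stable rank one,
reducibility of `(f, g)` is open in `f` and passes to coprime limits; polynomials are dense, so
linear factors `z - a` suffice, and the maximum principle settles those
(`isReduciblePair_coord_sub`). -/

section BanachAlgebra

variable {R : Type*} [NormedCommRing R] [NormedAlgebra ℂ R] [CompleteSpace R]

/-! ### Reducible pairs in a commutative Banach algebra -/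

/-- The pair `(f, g)` is reducible: `f` is a unit up to a multiple of `g`. -/
def IsReduciblePair {R : Type*} [CommRing R] (f g : R) : Prop := ∃ h, IsUnit (f + h * g)

theorem IsUnit.isReduciblePair {R : Type*} [CommRing R] {f : R} (hf : IsUnit f) (g : R) :
    IsReduciblePair f g := ⟨0, by simpa using hf⟩

theorem IsReduciblePair.mul {R : Type*} [CommRing R] {f₁ f₂ g : R} (h₁ : IsReduciblePair f₁ g)
    (h₂ : IsReduciblePair f₂ g) : IsReduciblePair (f₁ * f₂) g := by
  obtain ⟨h₁, hu₁⟩ := h₁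
  obtain ⟨h₂, hu₂⟩ := h₂
  refine ⟨f₁ * h₂ + h₁ * f₂ + h₁ * h₂ * g, ?_⟩
  convert hu₁.mul hu₂ using 1
  ring

theorem IsReduciblePair.multiset_prod {R : Type*} [CommRing R] {s : Multiset R} {g : R}
    (hs : ∀ f ∈ s, IsCoprime f g → IsReduciblePair f g) (h : IsCoprime s.prod g) :
    IsReduciblePair s.prod g := by
  induction s using Multiset.induction_on with
  | empty => simpa using isUnit_one.isReduciblePair g
  | cons a s ih =>
    rw [Multiset.prod_cons] at h ⊢
    exact (hs a (Multiset.mem_cons_self a s) h.of_mul_left_left).mul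
      (ih (fun f hf => hs f (Multiset.mem_cons_of_mem hf)) h.of_mul_left_right)

/-- The norm of the Bézout coefficient of `f` controls how far reducibility propagates from `f'`
to `f`. -/
theorem IsReduciblePair.of_norm_lt {R : Type*} [NormedCommRing R] [CompleteSpace R]
    {f f' g x y : R} (hxy : x * f + y * g = 1)
    (hn : ‖(f - f') * x‖ < 1) (h : IsReduciblePair f' g) : IsReduciblePair f g := by
  obtain ⟨h, hu⟩ := h
  have hv : IsUnit (1 - (f - f') * x) := isUnit_one_sub_of_norm_lt_one hn
  obtain ⟨v, hv⟩ := hv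
  -- Bézout gives `v * f = f' + (f - f') * y * g`.
  refine ⟨v⁻¹ * (h - (f - f') * y), ?_⟩
  have : f + ↑v⁻¹ * (h - (f - f') * y) * g = ↑v⁻¹ * (f' + h * g) := by
    rw [← Units.mul_right_inj v, Units.mul_inv_cancel_left, mul_add, mul_assoc,
      Units.mul_inv_cancel_left, hv]
    linear_combination (f' - f) * hxy
  rw [this]
  exact v⁻¹.isUnit.mul hu

theorem isOpen_setOf_isCoprime {R : Type*} [NormedCommRing R] [CompleteSpace R] (g : R) :
    IsOpen {f : R | IsCoprime f g} := by
  rw [isOpen_iff_mem_nhds]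
  rintro f ⟨x, y, hxy⟩
  have hc : Continuous fun f' : R => x * f' + y * g := by fun_prop
  have : ∀ᶠ f' in nhds f, IsUnit (x * f' + y * g) :=
    hc.continuousAt.eventually (Units.isOpen.mem_nhds (by simp [hxy]))
  filter_upwards [this] with f' hf'
  obtain ⟨u, hu⟩ := hf'
  refine ⟨u⁻¹ * x, u⁻¹ * y, ?_⟩
  rw [mul_assoc, mul_assoc, ← mul_add, ← hu, Units.inv_mul]

theorem isOpen_setOf_isReduciblePair {R : Type*} [NormedCommRing R] [CompleteSpace R] (g : R) :
    IsOpen {f : R | IsReduciblePair f g} := by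
  rw [isOpen_iff_mem_nhds]
  rintro f ⟨h, hu⟩
  have hc : Continuous fun f' : R => f' + h * g := by fun_prop
  filter_upwards [hc.continuousAt.eventually (Units.isOpen.mem_nhds hu)] with f' hf'
  exact ⟨h, hf'⟩

/-- If `f` is coprime to `g` and some `f'` close enough to `f` is reducible, then so is `f`. -/
theorem IsCoprime.eventually_isReduciblePair_imp {R : Type*} [NormedCommRing R] [CompleteSpace R]
    {f g : R} (h : IsCoprime f g) :
    ∀ᶠ f' in nhds f, IsReduciblePair f' g → IsReduciblePair f g := by
  obtain ⟨x, y, hxy⟩ := h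
  have hc : Continuous fun f' : R => ‖(f - f') * x‖ := by fun_prop
  filter_upwards [hc.continuousAt.eventually_lt_const (by simp : ‖(f - f) * x‖ < 1)] with f' hf' h
  exact h.of_norm_lt hxy hf'

/-! ### Units that are exponentials -/

/-- The strict derivative of `exp` at `0` is the identity, so `exp` is open there. -/
theorem range_exp_mem_nhds_one :
    Set.range (NormedSpace.exp : R → R) ∈ nhds (1 : R) := by
  have h := (hasStrictFDerivAt_exp_zero (𝕂 := ℂ) (𝔸 := R)).map_nhds_eq_of_surj
    (LinearMap.range_eq_top.2 fun x => ⟨x, rfl⟩)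
  rw [NormedSpace.exp_zero] at h
  rw [← h]
  exact Filter.range_mem_map

/-- Near a unit `u`, being an exponential is equivalent to `u` being one. -/
theorem eventually_mem_range_exp_iff (u : Rˣ) :
    ∀ᶠ v : R in nhds (u : R), v ∈ Set.range (NormedSpace.exp : R → R) ↔
      (u : R) ∈ Set.range (NormedSpace.exp : R → R) := by
  let := NormedAlgebra.restrictScalars ℚ ℂ R
  have hc : Continuous fun v : R => (↑u⁻¹ : R) * v := by fun_prop
  have h1 : ∀ᶠ v in nhds (u : R), (↑u⁻¹ : R) * v ∈ Set.range (NormedSpace.exp : R → R) :=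
    hc.continuousAt.preimage_mem_nhds (by
      rw [Units.inv_mul]
      exact range_exp_mem_nhds_one)
  filter_upwards [h1] with v hv
  obtain ⟨a, ha⟩ := hv
  have hv : v = u * NormedSpace.exp a := by rw [ha]; simp
  constructor
  · rintro ⟨b, hb⟩
    refine ⟨b + -a, ?_⟩
    rw [NormedSpace.exp_add, hb, hv, mul_assoc, ← NormedSpace.exp_add]
    simp
  · rintro ⟨b, hb⟩
    exact ⟨b + a, by rw [NormedSpace.exp_add, hb, hv]⟩

/-- A unit joined to an exponential by a path of units is an exponential. -/
theorem mem_range_exp_of_path {γ : unitInterval → R} (hγ : Continuous γ)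
    (hu : ∀ t, IsUnit (γ t)) (h0 : γ 0 ∈ Set.range (NormedSpace.exp : R → R)) (t : unitInterval) :
    γ t ∈ Set.range (NormedSpace.exp : R → R) := by
  have key : ∀ s, ∀ᶠ t in nhds s, γ t ∈ Set.range (NormedSpace.exp : R → R) ↔
      γ s ∈ Set.range (NormedSpace.exp : R → R) := fun s => by
    obtain ⟨u, hu⟩ := hu s
    have := eventually_mem_range_exp_iff u
    rw [hu] at this
    exact hγ.continuousAt.eventually this
  have hclopen : IsClopen {t | γ t ∈ Set.range (NormedSpace.exp : R → R)} := by
    constructor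
    · rw [← isOpen_compl_iff, isOpen_iff_mem_nhds]
      intro s hs
      filter_upwards [key s] with t ht
      exact fun h => hs (ht.1 h)
    · rw [isOpen_iff_mem_nhds]
      intro s hs
      filter_upwards [key s] with t ht
      exact ht.2 hs
  exact (hclopen.eq_univ ⟨0, h0⟩).ge (Set.mem_univ t)

/-! ### Exponentials of 2 × 2 matrices -/

theorem exists_exp_eq_conj {P Q D : Matrix (Fin 2) (Fin 2) R} (h : P * Q = 1)
    (hD : ∃ B, D = NormedSpace.exp B) : ∃ B, P * D * Q = NormedSpace.exp B := by
  let := NormedAlgebra.restrictScalars ℚ ℂ R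
  obtain ⟨B, rfl⟩ := hD
  exact ⟨P * B * Q, (Matrix.exp_units_conj ⟨P, Q, h, mul_eq_one_comm.1 h⟩ B).symm⟩

theorem exists_exp_eq_diagonal (p q : R) :
    ∃ B, !![NormedSpace.exp p, 0; 0, NormedSpace.exp q] = NormedSpace.exp B := by
  let := NormedAlgebra.restrictScalars ℚ ℂ R
  refine ⟨Matrix.diagonal ![p, q], ?_⟩
  rw [Matrix.exp_diagonal, Pi.exp_def]
  ext i j
  fin_cases i <;> fin_cases j <;> simp

theorem exists_exp_eq_lowerTriangular {p q : R}
    (hu : IsUnit (NormedSpace.exp p - NormedSpace.exp q)) (x : R) :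
    ∃ B, !![NormedSpace.exp p, 0; x, NormedSpace.exp q] = NormedSpace.exp B := by
  -- Conjugating the diagonal matrix by the unipotent with entry `k` creates the corner `(exp p -
  -- exp q) * k`.
  obtain ⟨k, rfl⟩ := hu.dvd (a := x)
  convert exists_exp_eq_conj (P := !![1, 0; k, 1]) (Q := !![1, 0; -k, 1]) ?_
    (exists_exp_eq_diagonal p q) using 3
  · ext i j
    fin_cases i <;> fin_cases j <;> simp [Matrix.mul_apply, Fin.sum_univ_two] <;> ring
  · ext i j
    fin_cases i <;> fin_cases j <;> simp [Matrix.mul_apply, Fin.sum_univ_two]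

theorem exists_exp_eq_upperTriangular {p q : R}
    (hu : IsUnit (NormedSpace.exp p - NormedSpace.exp q)) (x : R) :
    ∃ B, !![NormedSpace.exp p, x; 0, NormedSpace.exp q] = NormedSpace.exp B := by
  obtain ⟨k, rfl⟩ := hu.dvd (a := x)
  convert exists_exp_eq_conj (P := !![1, -k; 0, 1]) (Q := !![1, k; 0, 1]) ?_
    (exists_exp_eq_diagonal p q) using 3
  · ext i j
    fin_cases i <;> fin_cases j <;> simp [Matrix.mul_apply, Fin.sum_univ_two] <;> ring
  · ext i j
    fin_cases i <;> fin_cases j <;> simp [Matrix.mul_apply, Fin.sum_univ_two]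

/-- A unit `u` times a suitable scalar `t ≠ 0, 1` differs from `v` by a unit. -/
theorem exists_isUnit_smul_sub (u : Rˣ) (v : R) :
    ∃ t : ℂ, t ≠ 0 ∧ t - 1 ≠ 0 ∧ IsUnit (t • (u : R) - v) := by
  -- The first term puts `N` outside the spectrum of `u⁻¹ * v`; adding `2` excludes `t = 0, 1`.
  set N : ℝ := ‖(↑u⁻¹ : R) * v‖ * ‖(1 : R)‖ + 2 with hN
  have hN2 : 2 ≤ N := by
    have : 0 ≤ ‖(↑u⁻¹ : R) * v‖ * ‖(1 : R)‖ := by positivity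
    linarith
  refine ⟨(N : ℂ), ?_, ?_, ?_⟩
  · exact_mod_cast (by linarith : N ≠ 0)
  · have : N - 1 ≠ 0 := by linarith
    exact_mod_cast this
  · have h := spectrum.mem_resolventSet_of_norm_lt_mul (a := (↑u⁻¹ : R) * v) (k := (N : ℂ)) (by
      rw [Complex.norm_real, Real.norm_of_nonneg (by linarith)]
      linarith)
    convert u.isUnit.mul h using 1
    rw [mul_sub, Units.mul_inv_cancel_left, mul_comm, Algebra.smul_def]

/-- An invertible matrix whose upper left entry is a unit is a product of two exponentials, provided
all units are exponentials. -/
theorem exists_eq_exp_mul_exp_of_isUnit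
    (hexp : ∀ u : R, IsUnit u → u ∈ Set.range (NormedSpace.exp : R → R))
    {a b c d : R} (ha : IsUnit a) (hdet : IsUnit (a * d - b * c)) :
    ∃ B C, !![a, b; c, d] = NormedSpace.exp B * NormedSpace.exp C := by
  obtain ⟨u, rfl⟩ := ha
  -- The factors have diagonals `(t * u, det / u)` and `(t⁻¹, 1)`; `t` makes both differences units.
  obtain ⟨t, ht0, ht1, ht⟩ := exists_isUnit_smul_sub u (↑u⁻¹ * (u * d - b * c))
  have hβ : IsUnit (↑u⁻¹ * (u * d - b * c)) := u⁻¹.isUnit.mul hdet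
  have hα : IsUnit (t • (u : R)) := by
    rw [Algebra.smul_def]
    exact (ht0.isUnit.map (algebraMap ℂ R)).mul u.isUnit
  have htinv : IsUnit (algebraMap ℂ R t⁻¹) := (inv_ne_zero ht0).isUnit.map _
  obtain ⟨p, hp⟩ := hexp _ hα
  obtain ⟨q, hq⟩ := hexp _ hβ
  obtain ⟨r, hr⟩ := hexp _ htinv
  obtain ⟨s, hs⟩ := hexp 1 isUnit_one
  have htt : algebraMap ℂ R t * algebraMap ℂ R t⁻¹ = 1 := by
    rw [← map_mul, mul_inv_cancel₀ ht0, map_one]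
  have hr1 : IsUnit (NormedSpace.exp r - NormedSpace.exp s) := by
    rw [hr, hs, ← map_one (algebraMap ℂ R), ← map_sub]
    refine IsUnit.map _ (IsUnit.mk0 _ fun h => ht1 ?_)
    rw [sub_eq_zero] at h ⊢
    exact inv_eq_one.1 h
  obtain ⟨B, hB⟩ := exists_exp_eq_lowerTriangular (p := p) (q := q) (by rwa [hp, hq])
    (algebraMap ℂ R t * c)
  obtain ⟨C, hC⟩ := exists_exp_eq_upperTriangular hr1 (algebraMap ℂ R t⁻¹ * ↑u⁻¹ * b)
  refine ⟨B, C, ?_⟩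
  rw [← hB, ← hC, hp, hq, hr, hs, Algebra.smul_def]
  have huu : (u : R) * ↑u⁻¹ = 1 := u.mul_inv
  ext i j
  fin_cases i <;> fin_cases j <;> simp only [Matrix.mul_apply, Fin.sum_univ_two, Fin.zero_eta,
    Fin.mk_one, Matrix.of_apply, Matrix.cons_val', Matrix.cons_val_zero, Matrix.cons_val_one,
    Matrix.cons_val_fin_one]
  · linear_combination -(u : R) * htt
  · linear_combination -b * htt - b * algebraMap ℂ R t * algebraMap ℂ R t⁻¹ * huu
  · linear_combination -c * htt
  · linear_combination -(c * ↑u⁻¹ * b) * htt - d * huu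

/-- In a commutative Banach algebra of stable rank one in which all units are exponentials, every
invertible `2 × 2` matrix is a product of two exponentials. -/
theorem exists_eq_exp_mul_exp
    (hexp : ∀ u : R, IsUnit u → u ∈ Set.range (NormedSpace.exp : R → R))
    (hsr : ∀ f g : R, IsCoprime f g → IsReduciblePair f g) (A : GL (Fin 2) R) :
    ∃ B C : Matrix (Fin 2) (Fin 2) R,
      (A : Matrix (Fin 2) (Fin 2) R) = NormedSpace.exp B * NormedSpace.exp C := by
  obtain ⟨a, b, c, d, hA⟩ : ∃ a b c d, (A : Matrix (Fin 2) (Fin 2) R) = !![a, b; c, d] :=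
    ⟨_, _, _, _, Matrix.eta_fin_two _⟩
  have hdet : IsUnit (a * d - b * c) := by
    have := (Matrix.isUnit_iff_isUnit_det _).1 A.isUnit
    rwa [hA, Matrix.det_fin_two_of] at this
  have hcop : IsCoprime a c := by
    obtain ⟨u, hu⟩ := hdet
    refine ⟨↑u⁻¹ * d, -(↑u⁻¹ * b), ?_⟩
    linear_combination (↑u⁻¹ : R) * -hu + u.inv_mul
  obtain ⟨h, hh⟩ := hsr a c hcop
  -- This is the conjugate of `A` by `!![1, h; 0, 1]`.
  obtain ⟨B, C, hBC⟩ := exists_eq_exp_mul_exp_of_isUnit hexp (a := a + h * c)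
    (b := b + h * d - (a + h * c) * h) (c := c) (d := d - c * h) hh (by
      convert hdet using 1
      ring)
  have hPQ : !![1, -h; 0, 1] * !![1, h; 0, 1] = (1 : Matrix (Fin 2) (Fin 2) R) := by
    ext i j
    fin_cases i <;> fin_cases j <;> simp [Matrix.mul_apply, Fin.sum_univ_two]
  have hQP := mul_eq_one_comm.1 hPQ
  obtain ⟨B', hB'⟩ := exists_exp_eq_conj hPQ ⟨B, rfl⟩
  obtain ⟨C', hC'⟩ := exists_exp_eq_conj hPQ ⟨C, rfl⟩
  refine ⟨B', C', ?_⟩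
  rw [← hB', ← hC']
  calc (A : Matrix (Fin 2) (Fin 2) R)
      = !![1, -h; 0, 1] * (NormedSpace.exp B * NormedSpace.exp C) * !![1, h; 0, 1] := by
        rw [← hBC, hA]
        ext i j
        fin_cases i <;> fin_cases j <;> simp [Matrix.mul_apply, Fin.sum_univ_two] <;> ring
    _ = !![1, -h; 0, 1] * NormedSpace.exp B * (!![1, h; 0, 1] * !![1, -h; 0, 1])
          * NormedSpace.exp C * !![1, h; 0, 1] := by
        rw [hQP]
        simp only [mul_assoc, one_mul]
    _ = _ := by simp only [mul_assoc]

end BanachAlgebra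

/-! ### Dilations and units of the disc algebra -/

namespace discAlgebra

theorem extend_apply (g : Metric.closedBall (0 : ℂ) 1 → ℂ) {z : ℂ}
    (hz : z ∈ Metric.closedBall (0 : ℂ) 1) :
    Function.extend (Subtype.val : Metric.closedBall (0 : ℂ) 1 → ℂ) g 0 z = g ⟨z, hz⟩ :=
  Subtype.val_injective.extend_apply g 0 ⟨z, hz⟩

/-- The extension by zero of a member of the disc algebra. -/
noncomputable def toFun (f : discAlgebra) : ℂ → ℂ :=
  Function.extend (Subtype.val : Metric.closedBall (0 : ℂ) 1 → ℂ) f.1 0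

theorem toFun_apply (f : discAlgebra) {z : ℂ} (hz : z ∈ Metric.closedBall (0 : ℂ) 1) :
    toFun f z = f.1 ⟨z, hz⟩ :=
  extend_apply _ hz

theorem differentiableOn_toFun (f : discAlgebra) :
    DifferentiableOn ℂ (toFun f) (Metric.ball 0 1) := f.2

theorem continuousOn_toFun (f : discAlgebra) :
    ContinuousOn (toFun f) (Metric.closedBall 0 1) := by
  rw [continuousOn_iff_continuous_domRestrict]
  convert f.1.continuous using 1
  ext z
  exact toFun_apply f z.2

theorem mul_mem_closedBall (t : unitInterval) (z : Metric.closedBall (0 : ℂ) 1) :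
    ((t : ℝ) : ℂ) * z ∈ Metric.closedBall (0 : ℂ) 1 := by
  have hz := z.2
  rw [mem_closedBall_zero_iff] at hz ⊢
  rw [norm_mul, Complex.norm_real, Real.norm_of_nonneg t.2.1]
  exact mul_le_one₀ t.2.2 (norm_nonneg _) hz

/-- Multiplication of the closed disc by scalars in `[0, 1]`. -/
noncomputable def scale :
    C(unitInterval × Metric.closedBall (0 : ℂ) 1, Metric.closedBall (0 : ℂ) 1) where
  toFun p := ⟨((p.1 : ℝ) : ℂ) * p.2, mul_mem_closedBall p.1 p.2⟩
  continuous_toFun := by fun_prop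

/-- The dilation `z ↦ f (t z)` of a member of the disc algebra. -/
noncomputable def dilation (f : discAlgebra) (t : unitInterval) : discAlgebra :=
  ⟨(f.1.comp scale).curry t, by
    have hmaps : Set.MapsTo (fun z : ℂ => ((t : ℝ) : ℂ) * z) (Metric.ball 0 1)
        (Metric.ball 0 1) := fun z hz => by
      rw [mem_ball_zero_iff] at hz ⊢
      rw [norm_mul, Complex.norm_real, Real.norm_of_nonneg t.2.1]
      exact (mul_le_of_le_one_left (norm_nonneg _) t.2.2).trans_lt hz
    refine ((differentiableOn_toFun f).comp (by fun_prop) hmaps).congr fun z hz => ?_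
    rw [extend_apply _ (Metric.ball_subset_closedBall hz)]
    exact (toFun_apply f _).symm⟩

theorem dilation_apply (f : discAlgebra) (t : unitInterval) (z : Metric.closedBall (0 : ℂ) 1) :
    (dilation f t).1 z = f.1 ⟨((t : ℝ) : ℂ) * z, mul_mem_closedBall t z⟩ := rfl

theorem continuous_dilation (f : discAlgebra) : Continuous (dilation f) :=
  Continuous.subtype_mk (f.1.comp scale).curry.continuous _

theorem dilation_one (f : discAlgebra) : dilation f 1 = f := by
  apply Subtype.ext
  ext z
  rw [dilation_apply]
  congr 1
  ext
  simp

theorem isUnit_dilation {f : discAlgebra} (hf : IsUnit f) (t : unitInterval) :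
    IsUnit (dilation f t) := by
  obtain ⟨g, hg⟩ := hf.exists_right_inv
  refine IsUnit.of_mul_eq_one (dilation g t) (Subtype.ext ?_)
  ext z
  have := congrArg (fun h : discAlgebra => h.1 ⟨((t : ℝ) : ℂ) * z, mul_mem_closedBall t z⟩) hg
  exact this

theorem dilation_zero (f : discAlgebra) :
    dilation f 0 = algebraMap ℂ discAlgebra (toFun f 0) := by
  apply Subtype.ext
  ext z
  rw [dilation_apply, toFun_apply f (by simp)]
  change _ = f.1 _
  congr 1
  ext
  simp

/-- The dilations of `u` form a path of units from the nonzero constant `u(0)`, which has a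
logarithm, to `u`. -/
theorem mem_range_exp_of_isUnit (u : discAlgebra) (hu : IsUnit u) :
    u ∈ Set.range (NormedSpace.exp : discAlgebra → discAlgebra) := by
  have := mem_range_exp_of_path (continuous_dilation u) (isUnit_dilation hu) ?_ 1
  · rwa [dilation_one] at this
  · have h0 : toFun u 0 ≠ 0 := by
      obtain ⟨g, hg⟩ := hu.exists_right_inv
      have := congrArg (fun h : discAlgebra => h.1 ⟨0, by simp⟩) hg
      intro h
      rw [toFun_apply u (by simp)] at h
      change u.1 _ * g.1 _ = 1 at this
      rw [h, zero_mul] at this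
      exact zero_ne_one this
    refine ⟨algebraMap ℂ discAlgebra (Complex.log (toFun u 0)), ?_⟩
    rw [dilation_zero, ← NormedSpace.algebraMap_exp_comm, ← Complex.exp_eq_exp_ℂ,
      Complex.exp_log h0]

/-! ### Density of polynomials -/

/-- The coordinate function of the disc algebra. -/
noncomputable def coord : discAlgebra :=
  ⟨⟨Subtype.val, continuous_subtype_val⟩, by
    refine differentiableOn_id.congr fun z hz => ?_
    exact extend_apply _ (Metric.ball_subset_closedBall hz)⟩

/-- Evaluation at a point of the closed disc. -/
noncomputable def eval (z : Metric.closedBall (0 : ℂ) 1) : discAlgebra →ₐ[ℂ] ℂ :=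
  (ContinuousMap.evalAlgHom ℂ ℂ z).comp discAlgebra.val

theorem eval_apply (z : Metric.closedBall (0 : ℂ) 1) (f : discAlgebra) : eval z f = f.1 z := rfl

theorem eval_coord (z : Metric.closedBall (0 : ℂ) 1) : eval z coord = z := rfl

theorem eval_aeval_coord (z : Metric.closedBall (0 : ℂ) 1) (p : Polynomial ℂ) :
    eval z (Polynomial.aeval coord p) = p.eval (z : ℂ) := by
  rw [← Polynomial.aeval_algHom_apply, eval_coord, Polynomial.coe_aeval_eq_eval]

theorem norm_le_of_forall {f : discAlgebra} {C : ℝ} (hC : 0 ≤ C) (h : ∀ z, ‖eval z f‖ ≤ C) :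
    ‖f‖ ≤ C :=
  (ContinuousMap.norm_le f.1 hC).2 h

theorem dilation_mem_closure (f : discAlgebra) {t : unitInterval} (ht : t < 1) :
    dilation f t ∈ closure (Set.range (Polynomial.aeval (R := ℂ) coord)) := by
  -- The Taylor series lives on radius `s`, converges uniformly on radius `r`, and the dilation only
  -- sees radius `t`.
  obtain ⟨r, htr, hr1⟩ := exists_between (show (t : ℝ) < 1 from ht)
  obtain ⟨s, hrs, hs1⟩ := exists_between hr1
  have hr0 : 0 < r := t.2.1.trans_lt htr
  have hs0 : 0 < s := hr0.trans hrs
  lift r to NNReal using hr0.le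
  lift s to NNReal using hs0.le
  have hps := ((differentiableOn_toFun f).mono
    (Metric.closedBall_subset_ball hs1)).hasFPowerSeriesOnBall (by exact_mod_cast hs0)
  have hunif := hps.tendstoUniformlyOn (r' := r) (by exact_mod_cast hrs)
  set P := cauchyPowerSeries (toFun f) 0 s
  rw [Metric.mem_closure_iff]
  intro ε hε
  obtain ⟨n, hn⟩ := (Metric.tendstoUniformlyOn_iff.1 hunif (ε / 2) (by positivity)).exists
  refine ⟨_, ⟨∑ k ∈ Finset.range n, Polynomial.monomial k (P.coeff k * ((t : ℝ) : ℂ) ^ k), rfl⟩, ?_⟩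
  rw [dist_eq_norm]
  refine (norm_le_of_forall (by positivity) fun z => ?_).trans_lt (half_lt_self hε)
  have hz : ‖(z : ℂ)‖ ≤ 1 := mem_closedBall_zero_iff.1 z.2
  have htz : ((t : ℝ) : ℂ) * z ∈ Metric.ball (0 : ℂ) r := by
    rw [mem_ball_zero_iff, norm_mul, Complex.norm_real, Real.norm_of_nonneg t.2.1]
    exact (mul_le_of_le_one_right t.2.1 hz).trans_lt htr
  have h := (hn _ htz).le
  rw [dist_eq_norm, zero_add, toFun_apply f (mul_mem_closedBall t z)] at h
  rw [map_sub, eval_aeval_coord, eval_apply, dilation_apply]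
  rwa [show Polynomial.eval (z : ℂ) _ = P.partialSum n (((t : ℝ) : ℂ) * z) from ?_]
  rw [Polynomial.eval_finsetSum]
  refine Finset.sum_congr rfl fun k _ => ?_
  rw [Polynomial.eval_monomial, FormalMultilinearSeries.apply_eq_pow_smul_coeff, smul_eq_mul]
  ring

theorem denseRange_aeval_coord : DenseRange (Polynomial.aeval (R := ℂ) coord) := by
  intro f
  rw [← closure_closure]
  have h1 : (1 : unitInterval) ∈ closure (Set.Iio 1) := by
    rw [closure_Iio' ⟨0, Set.mem_Iio.2 zero_lt_one⟩]
    exact Set.self_mem_Iic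
  have := map_mem_closure (continuous_dilation f) h1 fun t ht => dilation_mem_closure f ht
  rwa [dilation_one] at this

theorem isUnit_coord_sub {a : ℂ} (ha : 1 < ‖a‖) :
    IsUnit (coord - algebraMap ℂ discAlgebra a) := by
  rw [← IsUnit.neg_iff, neg_sub]
  refine spectrum.mem_resolventSet_of_norm_lt_mul (lt_of_le_of_lt ?_ ha)
  refine mul_le_one₀ (norm_le_of_forall zero_le_one fun z => ?_) (norm_nonneg _)
    (norm_le_of_forall zero_le_one fun z => ?_)
  · rw [eval_coord]
    exact mem_closedBall_zero_iff.1 z.2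
  · simp

/-! ### Stable rank one -/

/-- If `g a ≠ 0`, then `z - a` and `g` generate the unit ideal. -/
theorem isCoprime_coord_sub (g : discAlgebra) (a : Metric.closedBall (0 : ℂ) 1)
    (ha : eval a g ≠ 0) : IsCoprime (coord - algebraMap ℂ discAlgebra a) g := by
  have hv : IsUnit (algebraMap ℂ discAlgebra (eval a g)) := ha.isUnit.map _
  -- The quotient `(g - g(a)) / (z - a)` may leave the algebra when `|a| = 1`. A polynomial `p` near
  -- `g` is divided instead: with `p - p(a) = (z - a) * q`, the element `g - (z - a) * q = p(a) + (g
  -- - p)` is still a unit.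
  have hc : Continuous fun q : discAlgebra => algebraMap ℂ discAlgebra (eval a q) + (g - q) := by
    have : Continuous fun q : discAlgebra => eval a q :=
      (continuous_eval_const a).comp continuous_subtype_val
    have := (continuous_algebraMap ℂ discAlgebra).comp this
    fun_prop
  obtain ⟨_, hu, p, rfl⟩ := denseRange_aeval_coord.inter_open_nonempty _
    (hc.isOpen_preimage _ Units.isOpen) ⟨g, by
      rw [Set.mem_preimage, sub_self, add_zero]
      exact hv⟩
  obtain ⟨q, hq⟩ := Polynomial.X_sub_C_dvd_sub_C_eval (p := p) (a := (a : ℂ))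
  have hq' := congrArg (Polynomial.aeval (R := ℂ) coord) hq
  simp only [map_sub, map_mul, Polynomial.aeval_X, Polynomial.aeval_C] at hq'
  obtain ⟨u, hu⟩ := hu
  beta_reduce at hu
  rw [eval_aeval_coord] at hu
  refine ⟨-(↑u⁻¹ * Polynomial.aeval coord q), ↑u⁻¹, ?_⟩
  linear_combination (↑u⁻¹ : discAlgebra) * (hq' - hu) + u.inv_mul

theorem eval_ne_zero_of_isCoprime {g : discAlgebra} {a : Metric.closedBall (0 : ℂ) 1}
    (h : IsCoprime (coord - algebraMap ℂ discAlgebra a) g) : eval a g ≠ 0 := by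
  obtain ⟨x, y, hxy⟩ := h
  intro h0
  have := congrArg (eval a) hxy
  simp [h0, eval_coord] at this

/-- The set `T` of bad points is open and lies in the disc, and `g` vanishes on its frontier. By the
maximum principle `g` vanishes on `T`, contradicting coprimality there. -/
theorem isReduciblePair_coord_sub {g : discAlgebra} {a : ℂ}
    (h : IsCoprime (coord - algebraMap ℂ discAlgebra a) g) :
    IsReduciblePair (coord - algebraMap ℂ discAlgebra a) g := by
  have hc : Continuous fun a : ℂ => coord - algebraMap ℂ discAlgebra a :=
    continuous_const.sub (continuous_algebraMap ℂ discAlgebra)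
  set T : Set ℂ := {a | IsCoprime (coord - algebraMap ℂ discAlgebra a) g ∧
    ¬ IsReduciblePair (coord - algebraMap ℂ discAlgebra a) g}
  have hTopen : IsOpen T := by
    rw [isOpen_iff_mem_nhds]
    rintro b ⟨hb, hb'⟩
    filter_upwards [hc.continuousAt.eventually ((isOpen_setOf_isCoprime g).mem_nhds hb),
      hc.continuousAt.eventually hb.eventually_isReduciblePair_imp] with b' h1 h2
    exact ⟨h1, fun h => hb' (h2 h)⟩
  have hTclosedBall : T ⊆ Metric.closedBall 0 1 := fun b hb => by
    by_contra hb1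
    rw [mem_closedBall_zero_iff, not_le] at hb1
    exact hb.2 ((isUnit_coord_sub hb1).isReduciblePair g)
  have hTclosure : closure T ⊆ Metric.closedBall 0 1 :=
    closure_minimal hTclosedBall Metric.isClosed_closedBall
  have hTball : T ⊆ Metric.ball 0 1 := by
    rw [← interior_closedBall (0 : ℂ) one_ne_zero]
    exact interior_maximal hTclosedBall hTopen
  -- At a frontier point with `g b ≠ 0` the pair is coprime, hence reducible since `b ∉ T`; openness
  -- of reducibility spreads this to nearby points of `T`.
  have hfrontier : Set.EqOn (toFun g) 0 (frontier T) := fun b hb => by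
    by_contra hgb
    have hb1 := hTclosure hb.1
    rw [toFun_apply g hb1] at hgb
    have hcop := isCoprime_coord_sub g ⟨b, hb1⟩ hgb
    have hbT : b ∉ T := by
      rw [hTopen.frontier_eq] at hb
      exact hb.2
    have hred : IsReduciblePair (coord - algebraMap ℂ discAlgebra b) g := by
      by_contra hred
      exact hbT ⟨hcop, hred⟩
    obtain ⟨b', hb', hb'T⟩ := mem_closure_iff.1 hb.1 _
      (hc.isOpen_preimage _ (isOpen_setOf_isReduciblePair g)) hred
    exact hb'T.2 hb'
  have hzero := Complex.eqOn_of_eqOn_frontier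
    (Metric.isBounded_closedBall.subset hTclosedBall)
    ⟨(differentiableOn_toFun g).mono hTball, (continuousOn_toFun g).mono hTclosure⟩
    (diffContOnCl_const (c := 0)) hfrontier
  by_contra hred
  have haT : a ∈ T := ⟨h, hred⟩
  refine eval_ne_zero_of_isCoprime (a := ⟨a, hTclosedBall haT⟩) h ?_
  rw [eval_apply, ← toFun_apply g (hTclosedBall haT)]
  exact hzero haT

theorem isReduciblePair_aeval_coord {p : Polynomial ℂ} {g : discAlgebra}
    (h : IsCoprime (Polynomial.aeval coord p) g) :
    IsReduciblePair (Polynomial.aeval coord p) g := by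
  rcases eq_or_ne p 0 with rfl | hp
  · rw [map_zero, isCoprime_zero_left] at h
    exact ⟨1, by simpa using h⟩
  rw [(IsAlgClosed.splits p).eq_prod_roots, map_mul, Polynomial.aeval_C, map_multiset_prod,
    Multiset.map_map] at h ⊢
  refine (IsUnit.isReduciblePair
    ((Polynomial.leadingCoeff_ne_zero.2 hp).isUnit.map _) g).mul ?_
  refine IsReduciblePair.multiset_prod (fun f hf => ?_) (IsCoprime.of_mul_left_right h)
  obtain ⟨a, -, rfl⟩ := Multiset.mem_map.1 hf
  rw [Function.comp_apply, map_sub, Polynomial.aeval_X, Polynomial.aeval_C]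
  exact isReduciblePair_coord_sub

/-- The disc algebra has stable rank one. -/
theorem isReduciblePair_of_isCoprime (f g : discAlgebra) (h : IsCoprime f g) :
    IsReduciblePair f g := by
  -- A polynomial near `f` is still coprime to `g`, and its reducibility passes back to `f`.
  have hev := h.eventually_isReduciblePair_imp.and ((isOpen_setOf_isCoprime g).mem_nhds h)
  obtain ⟨_, ⟨h1, h2⟩, p, rfl⟩ := mem_closure_iff_nhds.1 (denseRange_aeval_coord f) _ hev
  exact h1 (isReduciblePair_aeval_coord h2)

end discAlgebra

theorem mainTheorem5 (A : GL (Fin 2) discAlgebra) :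
    ∃ B C : Matrix (Fin 2) (Fin 2) discAlgebra,
      (A : Matrix (Fin 2) (Fin 2) discAlgebra) = NormedSpace.exp B * NormedSpace.exp C :=
  exists_eq_exp_mul_exp discAlgebra.mem_range_exp_of_isUnit
    discAlgebra.isReduciblePair_of_isCoprime A
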